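/- Let $\mathcal G=(\mathcal V,\mathcal E)$ be a finite directed network (parallel links allowed) with a source $\mathcal S$ and a destination $\mathcal T\neq\mathcal S$, in which each link $e$ is an erasure channel with erasure probability $p_e\in[0,1)$, i.e. has capacity $c_e=1-p_e$. Suppose that $\mathcal G$ is a single-bottleneck network: among the cuts $\{(u,v)\in\mathcal E: u\in X,\ v\notin X\}$ with $\mathcal S\in X\subseteq\mathcal V$ and $\mathcal T\notin X$, exactly one set of links has minimum total capacity. Then there is a max-flow subgraph comprising paths each of which has a single worst link. That is, there are finitely many directed simple paths $\mathcal P_f$, $f\in\mathcal F$, from $\mathcal S$ to $\mathcal T$, with rates $\lambda_f>0$, such that: (i) with $\Lambda_e=\sum_{f:\,e\in\mathcal P_f}\lambda_f$, the function $e\mapsto\Lambda_e$ is a maximum $\mathcal S$–$\mathcal T$ flow in $\mathcal G$ (in particular $\Lambda_e\le c_e$ for every link $e$); (ii) when the capacity of each link is divided among the path flows using it in proportion to their rates, so that $e\in\mathcal P_f$, as a link of the path of flow $f$, has erasure probability $$\hat p_{f,e}=1-\frac{\lambda_f}{\Lambda_e}\,(1-p_e),$$ every path $\mathcal P_f$ contains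 a link $m$ with $\hat p_{f,e}<\hat p_{f,m}$ for all links $e\neq m$ of $\mathcal P_f$. -/

import Mathlib

/-- A packet erasure network with node type `V` and link type `E` (parallel links between the same
two nodes are allowed): link `e` goes from `src e` to `tgt e` and erases a packet with probability
`p e`, where no link fails with probability one. There is one source and one destination. -/
structure ErasureNetwork (V E : Type*) where
  src : E → V
  tgt : E → V
  p : E → ℝ
  p_nonneg : ∀ e, 0 ≤ p e
  p_lt_one : ∀ e, p e < 1
  source : V
  sink : V
  source_ne_sink : source ≠ sink

namespace ErasureNetwork

variable {V E : Type*}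

/-- The capacity of a link: its success probability. -/
def cap (N : ErasureNetwork V E) (e : E) : ℝ := 1 - N.p e

/-- A source-sink cut, given by its source side. -/
def IsCut (N : ErasureNetwork V E) (X : Set V) : Prop := N.source ∈ X ∧ N.sink ∉ X

open Classical in
/-- The links that cross the cut from the source side to the sink side. -/
noncomputable def cutEdges [Fintype E] (N : ErasureNetwork V E) (X : Set V) : Finset E :=
  Finset.univ.filter fun e => N.src e ∈ X ∧ N.tgt e ∉ X

/-- The capacity of a cut. -/
noncomputable def cutCap [Fintype E] (N : ErasureNetwork V E) (X : Set V) : ℝ :=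
  ∑ e ∈ N.cutEdges X, N.cap e

/-- A cut of minimum capacity. -/
def IsMinCut [Fintype E] (N : ErasureNetwork V E) (X : Set V) : Prop :=
  N.IsCut X ∧ ∀ Y : Set V, N.IsCut Y → N.cutCap X ≤ N.cutCap Y

/-- A single-bottleneck network: there is exactly one minimum cut, a cut being identified with the
set of links that cross it. -/
def IsSingleBottleneck [Fintype E] (N : ErasureNetwork V E) : Prop :=
  ∃! D : Finset E, ∃ X : Set V, N.IsMinCut X ∧ N.cutEdges X = D

open Classical in
/-- Total flow on the links leaving `v`. -/
noncomputable def outflow [Fintype E] (N : ErasureNetwork V E) (g : E → ℝ) (v : V) : ℝ :=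
  ∑ e ∈ Finset.univ.filter (fun e => N.src e = v), g e

open Classical in
/-- Total flow on the links entering `v`. -/
noncomputable def inflow [Fintype E] (N : ErasureNetwork V E) (g : E → ℝ) (v : V) : ℝ :=
  ∑ e ∈ Finset.univ.filter (fun e => N.tgt e = v), g e

/-- A feasible source-sink flow. -/
structure IsFlow [Fintype E] (N : ErasureNetwork V E) (g : E → ℝ) : Prop where
  nonneg : ∀ e, 0 ≤ g e
  le_cap : ∀ e, g e ≤ N.cap e
  conserve : ∀ v, v ≠ N.source → v ≠ N.sink → N.inflow g v = N.outflow g v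

/-- The value of a flow: the net flow out of the source. -/
noncomputable def flowValue [Fintype E] (N : ErasureNetwork V E) (g : E → ℝ) : ℝ :=
  N.outflow g N.source - N.inflow g N.source

/-- A feasible flow of maximum value. -/
def IsMaxFlow [Fintype E] (N : ErasureNetwork V E) (g : E → ℝ) : Prop :=
  N.IsFlow g ∧ ∀ g' : E → ℝ, N.IsFlow g' → N.flowValue g' ≤ N.flowValue g

/-- The list of links is a directed walk from `u` to `v`. -/
def IsWalk (N : ErasureNetwork V E) : V → V → List E → Prop
  | u, v, [] => u = v
  | u, v, e :: es => N.src e = u ∧ N.IsWalk (N.tgt e) v es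

/-- The list of links is a source-sink path, i.e. a directed walk that repeats no node. -/
def IsPath (N : ErasureNetwork V E) (es : List E) : Prop :=
  N.IsWalk N.source N.sink es ∧ (N.source :: es.map N.tgt).Nodup

/-- A subgraph composed of finitely many flows on source-sink paths: flow `i` runs along `path i`
at rate `rate i > 0`. -/
structure PathFlows (N : ErasureNetwork V E) where
  num : ℕ
  path : Fin num → List E
  rate : Fin num → ℝ
  isPath : ∀ i, N.IsPath (path i)
  rate_pos : ∀ i, 0 < rate i

namespace PathFlows

variable {N : ErasureNetwork V E}

open Classical in
/-- The total rate of the path flows that use link `e`. -/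
noncomputable def load (F : N.PathFlows) (e : E) : ℝ :=
  ∑ i ∈ Finset.univ.filter (fun i => e ∈ F.path i), F.rate i

/-- The path flows form a max-flow subgraph: superposed, they are a maximum flow of the network. -/
def IsMaxFlowSubgraph [Fintype E] (F : N.PathFlows) : Prop := N.IsMaxFlow F.load

/-- The erasure probability of link `e` as a link of the `i`-th path, when the success probability
of each link is divided among the flows on it in proportion to their rates. -/
noncomputable def splitErasure (F : N.PathFlows) (i : Fin F.num) (e : E) : ℝ :=
  1 - F.rate i / F.load e * (1 - N.p e)

/-- The `i`-th path has a single worst link. -/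
def HasSingleWorstLink (F : N.PathFlows) (i : Fin F.num) : Prop :=
  ∃ m ∈ F.path i, ∀ e ∈ F.path i, e ≠ m → F.splitErasure i e < F.splitErasure i m

end PathFlows

end ErasureNetwork

/-! Splitting a link among its flows in proportion to their rates gives flow `f` the capacity `λ_f
c_e / Λ_e`. This equals `λ_f` where the link is saturated and is strictly larger elsewhere. So a
path has a single worst link as soon as it uses exactly one saturated link, and it suffices to find
a maximum flow, made of paths, whose only saturated links are those of the bottleneck and whose
paths cross the bottleneck once.

Uniqueness of the minimum cut supplies the slack: every other cut set is strictly larger, so all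
capacities off the bottleneck can be lowered by a small `ε` without lowering the minimum cut value.
Max-flow min-cut for the lowered capacities then gives a maximum flow of the original network that
is unsaturated off the bottleneck (`exists_flow_lt_cap_off_bottleneck`). Extracting paths
(`exists_listLoad_le`) keeps the value and only decreases link flows, so the slack survives.
Equality in weak duality (`tight_of_divergence_source_eq_cut`) saturates the bottleneck and empties
the links going back across it, so no path can return and cross twice
(`IsWalk.exists_unique_crossing`). -/

namespace ErasureNetwork

variable {V E : Type*}

/-! ### Divergence of a flow, and weak duality with cuts. -/

section Divergence

variable [Fintype E] (N : ErasureNetwork V E)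

/-- Net flow out of a node. -/
noncomputable def divergence (g : E → ℝ) (v : V) : ℝ := N.outflow g v - N.inflow g v

open Classical in
theorem divergence_eq_sum (g : E → ℝ) (v : V) :
    N.divergence g v =
      ∑ e, g e * ((if N.src e = v then 1 else 0) - (if N.tgt e = v then 1 else 0)) := by
  simp only [divergence, outflow, inflow, Finset.sum_filter, ← Finset.sum_sub_distrib]
  refine Finset.sum_congr rfl fun e _ => ?_
  split_ifs <;> simp

theorem divergence_add (g h : E → ℝ) (v : V) :
    N.divergence (g + h) v = N.divergence g v + N.divergence h v := by
  simp only [divergence_eq_sum, Pi.add_apply, add_mul, Finset.sum_add_distrib]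

theorem divergence_smul (r : ℝ) (g : E → ℝ) (v : V) :
    N.divergence (r • g) v = r * N.divergence g v := by
  simp only [divergence_eq_sum, Pi.smul_apply, smul_eq_mul, mul_assoc, Finset.mul_sum]

theorem divergence_zero (v : V) : N.divergence 0 v = 0 := by
  simp [divergence_eq_sum]

open Classical in
theorem divergence_single (e : E) (v : V) :
    N.divergence (Pi.single e 1) v =
      (if N.src e = v then 1 else 0) - (if N.tgt e = v then 1 else 0) := by
  rw [divergence_eq_sum, Finset.sum_eq_single e]
  · simp
  · intro b _ hb
    simp [Pi.single_eq_of_ne hb]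
  · simp

theorem continuous_divergence (v : V) : Continuous fun g : E → ℝ => N.divergence g v := by
  simp only [divergence_eq_sum]
  fun_prop

/-- The function satisfies flow conservation at every node except source and sink. -/
def Conserves (g : E → ℝ) : Prop :=
  ∀ v, v ≠ N.source → v ≠ N.sink → N.divergence g v = 0

open Classical in
/-- The net flow across a cut is the value of the flow. -/
theorem divergence_source_eq_net [Finite V] {g : E → ℝ} (hg : N.Conserves g) {X : Set V}
    (hX : N.IsCut X) :
    N.divergence g N.source =
      ∑ e, g e * ((if N.src e ∈ X then 1 else 0) - (if N.tgt e ∈ X then 1 else 0)) := by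
  cases nonempty_fintype V
  -- Sum the divergence over `X` and exchange the sums: a link contributes only if exactly one
  -- endpoint lies in `X`. By conservation only the source term survives on the left.
  have key : ∑ v, (if v ∈ X then (1 : ℝ) else 0) * N.divergence g v =
      ∑ e, g e * ((if N.src e ∈ X then 1 else 0) - (if N.tgt e ∈ X then 1 else 0)) := by
    simp only [divergence_eq_sum, Finset.mul_sum]
    rw [Finset.sum_comm]
    refine Finset.sum_congr rfl fun e _ => ?_
    have h : ∀ w : V, ∑ v, (if v ∈ X then (1 : ℝ) else 0) * (if w = v then 1 else 0) =
        if w ∈ X then 1 else 0 := by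
      intro w
      simp
    rw [← h, ← h (N.tgt e), ← Finset.sum_sub_distrib, Finset.mul_sum]
    refine Finset.sum_congr rfl fun v _ => ?_
    ring
  rw [← key, Finset.sum_eq_single N.source]
  · simp [hX.1]
  · intro v _ hv
    by_cases ht : v = N.sink
    · subst ht
      simp [hX.2]
    · simp [hg v hv ht]
  · simp

open Classical in
theorem sum_cutEdges_eq (c : E → ℝ) (X : Set V) :
    ∑ e ∈ N.cutEdges X, c e = ∑ e, if N.src e ∈ X ∧ N.tgt e ∉ X then c e else 0 := by
  rw [cutEdges, Finset.sum_filter]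

/-- Weak duality between flows and cuts. -/
theorem divergence_source_le_cut [Finite V] {g c : E → ℝ} (hg : N.Conserves g)
    (h0 : ∀ e, 0 ≤ g e) (hc : ∀ e, g e ≤ c e) {X : Set V} (hX : N.IsCut X) :
    N.divergence g N.source ≤ ∑ e ∈ N.cutEdges X, c e := by
  classical
  rw [N.divergence_source_eq_net hg hX, sum_cutEdges_eq]
  refine Finset.sum_le_sum fun e _ => ?_
  have := h0 e
  have := hc e
  by_cases h1 : N.src e ∈ X <;> by_cases h2 : N.tgt e ∈ X <;> simp [h1, h2] <;> linarith

/-- Weak duality holds link by link, so equality of the totals forces equality in every term. -/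
theorem tight_of_divergence_source_eq_cut [Finite V] {g c : E → ℝ} (hg : N.Conserves g)
    (h0 : ∀ e, 0 ≤ g e) (hc : ∀ e, g e ≤ c e) {X : Set V} (hX : N.IsCut X)
    (heq : N.divergence g N.source = ∑ e ∈ N.cutEdges X, c e) :
    (∀ e, N.src e ∈ X → N.tgt e ∉ X → g e = c e) ∧
      ∀ e, N.src e ∉ X → N.tgt e ∈ X → g e = 0 := by
  classical
  rw [N.divergence_source_eq_net hg hX, sum_cutEdges_eq] at heq
  rw [Finset.sum_eq_sum_iff_of_le] at heq
  · refine ⟨fun e h1 h2 => ?_, fun e h1 h2 => ?_⟩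
    · simpa [h1, h2] using heq e (Finset.mem_univ e)
    · simpa [h1, h2] using heq e (Finset.mem_univ e)
  · intro e _
    have := h0 e
    have := hc e
    by_cases h1 : N.src e ∈ X <;> by_cases h2 : N.tgt e ∈ X <;> simp [h1, h2] <;> linarith

theorem divergence_source_eq_cut_of_tight [Finite V] {g c : E → ℝ} (hg : N.Conserves g)
    {X : Set V} (hX : N.IsCut X)
    (hfwd : ∀ e, N.src e ∈ X → N.tgt e ∉ X → g e = c e)
    (hbwd : ∀ e, N.src e ∉ X → N.tgt e ∈ X → g e = 0) :
    N.divergence g N.source = ∑ e ∈ N.cutEdges X, c e := by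
  classical
  rw [N.divergence_source_eq_net hg hX, sum_cutEdges_eq]
  refine Finset.sum_congr rfl fun e _ => ?_
  by_cases h1 : N.src e ∈ X <;> by_cases h2 : N.tgt e ∈ X <;> simp [h1, h2]
  · exact hfwd e h1 h2
  · exact hbwd e h1 h2

end Divergence

/-! ### Max-flow min-cut via residual directions. -/

section MaxFlowMinCut

variable [Fintype E] (N : ErasureNetwork V E)

/-- A maximum flow exists, by compactness. -/
theorem exists_maximum_flow {c : E → ℝ} (hc : ∀ e, 0 ≤ c e) :
    ∃ g : E → ℝ, ((∀ e, 0 ≤ g e) ∧ (∀ e, g e ≤ c e) ∧ N.Conserves g) ∧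
      ∀ h : E → ℝ, (∀ e, 0 ≤ h e) → (∀ e, h e ≤ c e) → N.Conserves h →
        N.divergence h N.source ≤ N.divergence g N.source := by
  have hclosed : IsClosed {g : E → ℝ | N.Conserves g} := by
    simp only [Conserves, Set.ofPred_forall]
    exact isClosed_iInter fun v => isClosed_iInter fun _ => isClosed_iInter fun _ =>
      isClosed_eq (N.continuous_divergence v) continuous_const
  have hcomp : IsCompact (Set.Icc 0 c ∩ {g : E → ℝ | N.Conserves g}) :=
    isCompact_Icc.inter_right hclosed
  obtain ⟨g, ⟨⟨h0, h1⟩, h2⟩, hmax⟩ := hcomp.exists_isMaxOn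
    ⟨0, ⟨le_refl _, hc⟩, fun v _ _ => N.divergence_zero v⟩
    (N.continuous_divergence N.source).continuousOn
  exact ⟨g, ⟨h0, h1, h2⟩, fun h a b d => hmax ⟨⟨a, b⟩, d⟩⟩

open Classical in
/-- A direction in which a unit of flow can be pushed from the source to `v`, to first order, when
the current flow is `g` and the capacities are `c`. -/
structure IsResidualDirection (c g : E → ℝ) (v : V) (d : E → ℝ) : Prop where
  divergence_eq : ∀ w, N.divergence d w =
    (if N.source = w then 1 else 0) - (if v = w then 1 else 0)
  lt_cap : ∀ e, 0 < d e → g e < c e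
  pos : ∀ e, d e < 0 → 0 < g e

/-- Add one unit on `e`. With `pull`, this closes the set of residually reachable nodes under
unsaturated links forwards and flow-carrying links backwards. Directions are real vectors rather
than paths, so no simplicity of an augmenting path is needed. -/
theorem IsResidualDirection.push {N : ErasureNetwork V E} {c g d : E → ℝ} {e : E}
    (hd : N.IsResidualDirection c g (N.src e) d) (he : g e < c e) :
    ∃ d', N.IsResidualDirection c g (N.tgt e) d' := by
  classical
  refine ⟨d + Pi.single e 1, fun w => ?_, fun a ha => ?_, fun a ha => ?_⟩
  · rw [divergence_add, hd.divergence_eq, divergence_single]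
    ring
  · by_cases h : a = e
    · exact h ▸ he
    · exact hd.lt_cap a (by simpa [Pi.single_eq_of_ne h] using ha)
  · by_cases h : a = e
    · subst h
      simp only [Pi.add_apply, Pi.single_eq_same] at ha
      exact hd.pos a (by linarith)
    · exact hd.pos a (by simpa [Pi.single_eq_of_ne h] using ha)

theorem IsResidualDirection.pull {N : ErasureNetwork V E} {c g d : E → ℝ} {e : E}
    (hd : N.IsResidualDirection c g (N.tgt e) d) (he : 0 < g e) :
    ∃ d', N.IsResidualDirection c g (N.src e) d' := by
  classical
  refine ⟨d + (-1 : ℝ) • Pi.single e 1, fun w => ?_, fun a ha => ?_, fun a ha => ?_⟩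
  · rw [divergence_add, divergence_smul, hd.divergence_eq, divergence_single]
    ring
  · by_cases h : a = e
    · subst h
      simp only [Pi.add_apply, Pi.smul_apply, Pi.single_eq_same, smul_eq_mul] at ha
      exact hd.lt_cap a (by linarith)
    · exact hd.lt_cap a (by simpa [Pi.single_eq_of_ne h] using ha)
  · by_cases h : a = e
    · exact h ▸ he
    · exact hd.pos a (by simpa [Pi.single_eq_of_ne h] using ha)

/-- A small step in a residual direction is feasible. -/
theorem exists_step {c g d : E → ℝ} (h0 : ∀ e, 0 ≤ g e) (hc : ∀ e, g e ≤ c e)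
    (hlt : ∀ e, 0 < d e → g e < c e) (hpos : ∀ e, d e < 0 → 0 < g e) :
    ∃ t : ℝ, 0 < t ∧ ∀ e, 0 ≤ g e + t * d e ∧ g e + t * d e ≤ c e := by
  have hev : ∀ᶠ t : ℝ in nhdsWithin 0 (Set.Ioi 0),
      ∀ e, 0 ≤ g e + t * d e ∧ g e + t * d e ≤ c e := by
    refine Filter.eventually_all.2 fun e => ?_
    have hlim : Filter.Tendsto (fun t : ℝ => g e + t * d e) (nhdsWithin 0 (Set.Ioi 0))
        (nhds (g e)) := by
      have : Continuous fun t : ℝ => g e + t * d e := by fun_prop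
      simpa using (this.tendsto 0).mono_left nhdsWithin_le_nhds
    rcases lt_trichotomy (d e) 0 with h | h | h
    · filter_upwards [hlim.eventually_const_lt (hpos e h), self_mem_nhdsWithin] with t ht ht0
      refine ⟨ht.le, ?_⟩
      have : t * d e ≤ 0 := mul_nonpos_of_nonneg_of_nonpos (le_of_lt ht0) h.le
      linarith [hc e]
    · exact Filter.Eventually.of_forall fun t => by simp [h, h0 e, hc e]
    · filter_upwards [hlim.eventually_lt_const (hlt e h), self_mem_nhdsWithin] with t ht ht0
      refine ⟨?_, ht.le⟩
      have : 0 ≤ t * d e := mul_nonneg (le_of_lt ht0) h.le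
      linarith [h0 e]
  obtain ⟨t, ht, ht0⟩ := (hev.and self_mem_nhdsWithin).exists
  exact ⟨t, ht0, ht⟩

/-- The max-flow min-cut theorem. -/
theorem exists_flow_eq_cut [Finite V] {c : E → ℝ} (hc : ∀ e, 0 ≤ c e) :
    ∃ g : E → ℝ, ((∀ e, 0 ≤ g e) ∧ (∀ e, g e ≤ c e) ∧ N.Conserves g) ∧
      ∃ X : Set V, N.IsCut X ∧ N.divergence g N.source = ∑ e ∈ N.cutEdges X, c e := by
  classical
  obtain ⟨g, ⟨h0, h1, h2⟩, hmax⟩ := N.exists_maximum_flow hc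
  -- The cut is the set of residually reachable nodes. If it contained the sink, a small step `t` in
  -- that direction would raise the maximum value by `t`.
  refine ⟨g, ⟨h0, h1, h2⟩, {v | ∃ d, N.IsResidualDirection c g v d}, ?_⟩
  have hcut : N.IsCut {v | ∃ d, N.IsResidualDirection c g v d} := by
    refine ⟨⟨0, fun w => by simp [divergence_zero], by simp, by simp⟩, ?_⟩
    rintro ⟨d, hd⟩
    obtain ⟨t, ht, hfeas⟩ := exists_step h0 h1 hd.lt_cap hd.pos
    have hle := hmax (g + t • d) (fun e => (hfeas e).1) (fun e => (hfeas e).2) (by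
      intro v hs ht
      rw [divergence_add, divergence_smul, h2 v hs ht, hd.divergence_eq]
      simp [hs.symm, ht.symm])
    rw [divergence_add, divergence_smul, hd.divergence_eq] at hle
    simp only [if_true, if_neg N.source_ne_sink.symm] at hle
    linarith
  refine ⟨hcut, N.divergence_source_eq_cut_of_tight h2 hcut ?_ ?_⟩
  · rintro e ⟨d, hd⟩ h
    by_contra hne
    exact h (hd.push (lt_of_le_of_ne (h1 e) hne))
  · rintro e h ⟨d, hd⟩
    by_contra hne
    exact h (hd.pull (lt_of_le_of_ne (h0 e) (Ne.symm hne)))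

end MaxFlowMinCut

/-! ### Simple walks, cut crossings, and paths supporting a flow. -/

section Walks

variable (N : ErasureNetwork V E)

/-- Every node on a simple walk starts a simple walk along a suffix. -/
theorem exists_suffix_isWalk {u v w : V} {es : List E} (hw : N.IsWalk u v es)
    (hn : (u :: es.map N.tgt).Nodup) (hmem : w ∈ u :: es.map N.tgt) :
    ∃ fs, fs ⊆ es ∧ N.IsWalk w v fs ∧ (w :: fs.map N.tgt).Nodup := by
  induction es generalizing u with
  | nil =>
    obtain rfl : w = u := by simpa using hmem
    exact ⟨[], by simp, hw, by simp⟩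
  | cons e es ih =>
    rcases List.mem_cons.1 hmem with rfl | h
    · exact ⟨e :: es, fun _ h => h, hw, hn⟩
    · obtain ⟨fs, h1, h2, h3⟩ := ih hw.2 (List.nodup_cons.1 hn).2 h
      exact ⟨fs, List.subset_cons_of_subset _ h1, h2, h3⟩

theorem IsWalk.src_notMem {N : ErasureNetwork V E} {X : Set V} {u v : V} {es : List E}
    (hw : N.IsWalk u v es) (hu : u ∉ X)
    (hback : ∀ e ∈ es, N.src e ∉ X → N.tgt e ∉ X) : ∀ e ∈ es, N.src e ∉ X := by
  induction es generalizing u with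
  | nil => simp
  | cons a es ih =>
    have ha : N.src a ∉ X := hw.1 ▸ hu
    intro e he
    rcases List.mem_cons.1 he with rfl | he
    · exact ha
    · exact ih hw.2 (hback a (by simp) ha) (fun b hb => hback b (by simp [hb])) e he

/-- A walk that leaves a set of nodes and never reenters it crosses its boundary in one link. -/
theorem IsWalk.exists_unique_crossing {N : ErasureNetwork V E} {X : Set V} {u v : V} {es : List E}
    (hw : N.IsWalk u v es) (hu : u ∈ X) (hv : v ∉ X)
    (hback : ∀ e ∈ es, N.src e ∉ X → N.tgt e ∉ X) :
    ∃ m ∈ es, (N.src m ∈ X ∧ N.tgt m ∉ X) ∧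
      ∀ e ∈ es, N.src e ∈ X → N.tgt e ∉ X → e = m := by
  induction es generalizing u with
  | nil =>
    have huv : u = v := hw
    exact absurd (huv ▸ hu) hv
  | cons a es ih =>
    have hback' : ∀ e ∈ es, N.src e ∉ X → N.tgt e ∉ X := fun b hb => hback b (by simp [hb])
    by_cases ha : N.tgt a ∈ X
    · obtain ⟨m, hm, hmX, huniq⟩ := ih hw.2 ha hback'
      refine ⟨m, by simp [hm], hmX, fun e he h1 h2 => ?_⟩
      rcases List.mem_cons.1 he with rfl | he
      · exact absurd ha h2
      · exact huniq e he h1 h2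
    · refine ⟨a, by simp, ⟨hw.1 ▸ hu, ha⟩, fun e he h1 h2 => ?_⟩
      rcases List.mem_cons.1 he with rfl | he
      · rfl
      · exact absurd h1 (hw.2.src_notMem ha hback' e he)

open Classical in
/-- The unit flow along a list of links. -/
noncomputable def unitFlow (es : List E) (e : E) : ℝ := if e ∈ es then 1 else 0

open Classical in
theorem IsWalk.divergence_unitFlow [Fintype E] {N : ErasureNetwork V E} {u v : V} {es : List E}
    (hw : N.IsWalk u v es) (hn : es.Nodup) (w : V) :
    N.divergence (unitFlow es) w = (if u = w then 1 else 0) - (if v = w then 1 else 0) := by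
  induction es generalizing u with
  | nil =>
    have huv : u = v := hw
    have h0 : unitFlow ([] : List E) = 0 := by
      funext e
      simp [unitFlow]
    simp [h0, divergence_zero, huv]
  | cons a es ih =>
    have hsum : unitFlow (a :: es) = Pi.single a 1 + unitFlow es := by
      funext e
      by_cases h : e = a
      · subst h
        simp [unitFlow, (List.nodup_cons.1 hn).1]
      · simp [unitFlow, h]
    rw [hsum, divergence_add, divergence_single, ih hw.2 (List.nodup_cons.1 hn).2, hw.1]
    ring

open Classical in
theorem IsPath.divergence_unitFlow [Fintype E] {N : ErasureNetwork V E} {es : List E}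
    (h : N.IsPath es) (w : V) :
    N.divergence (unitFlow es) w =
      (if N.source = w then 1 else 0) - (if N.sink = w then 1 else 0) :=
  h.1.divergence_unitFlow (List.Nodup.of_map _ (List.nodup_cons.1 h.2).2) w

/-- A flow of positive value is positive along some path. -/
theorem exists_isPath_of_pos [Finite V] [Fintype E] {g : E → ℝ} (hg : N.Conserves g)
    (h0 : ∀ e, 0 ≤ g e) (hpos : 0 < N.divergence g N.source) :
    ∃ es, N.IsPath es ∧ ∀ e ∈ es, 0 < g e := by
  by_contra hcon
  -- `X` consists of the nodes with no simple walk to the sink along positive flow. No positive link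
  -- can leave it, so weak duality with `g` itself as the capacity bounds the value by zero.
  let X : Set V := {u | ¬ ∃ es, (N.IsWalk u N.sink es ∧ (u :: es.map N.tgt).Nodup) ∧
    ∀ e ∈ es, 0 < g e}
  have hX : N.IsCut X := ⟨hcon, fun h => h ⟨[], ⟨rfl, by simp⟩, by simp⟩⟩
  have hle := N.divergence_source_le_cut (c := fun e => g e) hg h0 (fun e => le_rfl) hX
  refine hpos.not_ge (hle.trans (le_of_eq (Finset.sum_eq_zero fun e he => ?_)))
  classical
  obtain ⟨h1, h2⟩ : N.src e ∈ X ∧ N.tgt e ∉ X := by simpa [cutEdges] using he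
  obtain ⟨es, ⟨hw, hn⟩, hes⟩ := not_not.1 h2
  by_contra hne
  have hge : 0 < g e := lt_of_le_of_ne (h0 e) (Ne.symm hne)
  -- If the walk already visits `N.src e`, prepending `e` would repeat a node; the suffix from that
  -- node serves instead.
  by_cases hmem : N.src e ∈ N.tgt e :: es.map N.tgt
  · obtain ⟨fs, hsub, hfw, hfn⟩ := N.exists_suffix_isWalk hw hn hmem
    exact h1 ⟨fs, ⟨hfw, hfn⟩, fun a ha => hes a (hsub ha)⟩
  · refine h1 ⟨e :: es, ⟨⟨rfl, hw⟩, ?_⟩, ?_⟩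
    · exact List.nodup_cons.2 ⟨hmem, hn⟩
    · intro a ha
      rcases List.mem_cons.1 ha with rfl | ha
      · exact hge
      · exact hes a ha

end Walks

/-! ### Path decomposition and split erasure probabilities. -/

section Decomposition

variable (N : ErasureNetwork V E)

/-- The superposition of weighted lists of links. -/
noncomputable def listLoad (L : List (List E × ℝ)) : E → ℝ :=
  (L.map fun q => q.2 • unitFlow q.1).sum

/-- Every flow of nonnegative value dominates a superposition of path flows of the same value. -/
theorem exists_listLoad_le [Finite V] [Fintype E] {g : E → ℝ} (hg : N.Conserves g)
    (h0 : ∀ e, 0 ≤ g e) (hval : 0 ≤ N.divergence g N.source) :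
    ∃ L : List (List E × ℝ), (∀ q ∈ L, N.IsPath q.1 ∧ 0 < q.2) ∧
      (∀ e, listLoad L e ≤ g e) ∧
      N.divergence (listLoad L) N.source = N.divergence g N.source := by
  classical
  -- Induction on the size of the support: subtracting the least flow on a positive path empties its
  -- minimizing link `m`.
  induction hk : (Finset.univ.filter fun e => g e ≠ 0).card using Nat.strong_induction_on
    generalizing g with
  | _ k ih =>
  rcases hval.eq_or_lt with hzero | hpos
  -- At value zero `g` may still carry a circulation. It is discarded, which is why the conclusion
  -- is domination and not equality.
  · exact ⟨[], by simp, by simpa [listLoad] using h0, by simp [listLoad, divergence_zero, ← hzero]⟩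
  obtain ⟨es, hes, hpath⟩ := N.exists_isPath_of_pos hg h0 hpos
  have hdiv : N.divergence (unitFlow es) N.source = 1 := by
    simp [hes.divergence_unitFlow, N.source_ne_sink.symm]
  have hne : es.toFinset.Nonempty := by
    rw [List.toFinset_nonempty_iff]
    rintro rfl
    exact N.source_ne_sink hes.1
  obtain ⟨m, hm, hmin⟩ := es.toFinset.exists_min_image g hne
  rw [List.mem_toFinset] at hm
  -- If the path can carry the whole value, one path flow is enough. Otherwise removing `g m` leaves
  -- a positive value, as the induction requires.
  by_cases hcase : N.divergence g N.source ≤ g m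
  · refine ⟨[(es, N.divergence g N.source)], by simp [hes, hpos], fun e => ?_, ?_⟩
    · by_cases he : e ∈ es
      · simpa [listLoad, unitFlow, he] using hcase.trans (hmin e (by simpa using he))
      · simpa [listLoad, unitFlow, he] using h0 e
    · simp [listLoad, divergence_smul, hdiv]
  push Not at hcase
  have hrest : ∀ e, (g + (-g m) • unitFlow es) e = if e ∈ es then g e - g m else g e := by
    intro e
    by_cases he : e ∈ es <;> simp [unitFlow, he, sub_eq_add_neg]
  obtain ⟨L, hL, hLle, hLval⟩ := ih _ (by
      rw [← hk]
      refine Finset.card_lt_card (Finset.ssubset_iff_of_subset ?_ |>.2 ⟨m, ?_, ?_⟩)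
      · intro e he
        rw [Finset.mem_filter] at he ⊢
        refine ⟨he.1, fun hge => ?_⟩
        by_cases hmem : e ∈ es
        · exact (hpath e hmem).ne' hge
        · exact he.2 (by rw [hrest, if_neg hmem, hge])
      · simpa using (hpath m hm).ne'
      · simp only [Finset.mem_filter, hrest]
        simp [hm])
    (g := g + (-g m) • unitFlow es)
    (by
      intro v hs ht
      rw [divergence_add, divergence_smul, hg v hs ht, hes.divergence_unitFlow]
      simp [hs.symm, ht.symm])
    (by
      intro e
      rw [hrest]
      split_ifs with he
      · exact sub_nonneg.2 (hmin e (by simpa using he))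
      · exact h0 e)
    (by
      rw [divergence_add, divergence_smul, hdiv]
      linarith) rfl
  have hsum : listLoad ((es, g m) :: L) = g m • unitFlow es + listLoad L := by
    simp [listLoad]
  refine ⟨(es, g m) :: L, ?_, fun e => ?_, ?_⟩
  · intro q hq
    rcases List.mem_cons.1 hq with rfl | hq
    · exact ⟨hes, hpath m hm⟩
    · exact hL q hq
  · have := hLle e
    rw [hsum]
    simp only [Pi.add_apply, Pi.smul_apply, smul_eq_mul] at this ⊢
    linarith
  · rw [hsum, divergence_add, hLval, divergence_add, divergence_smul, divergence_smul]
    ring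

/-- The path flows given by a list of weighted paths. -/
noncomputable def PathFlows.ofList {N : ErasureNetwork V E} (L : List (List E × ℝ))
    (hL : ∀ q ∈ L, N.IsPath q.1 ∧ 0 < q.2) : N.PathFlows where
  num := L.length
  path i := (L.get i).1
  rate i := (L.get i).2
  isPath i := (hL _ (L.get_mem i)).1
  rate_pos i := (hL _ (L.get_mem i)).2

theorem PathFlows.load_eq_sum {N : ErasureNetwork V E} (F : N.PathFlows) :
    F.load = ∑ i, F.rate i • unitFlow (F.path i) := by
  classical
  funext e
  simp [PathFlows.load, Finset.sum_filter, unitFlow, Finset.sum_apply]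

theorem PathFlows.load_ofList {N : ErasureNetwork V E} (L : List (List E × ℝ))
    (hL : ∀ q ∈ L, N.IsPath q.1 ∧ 0 < q.2) : (PathFlows.ofList L hL).load = listLoad L := by
  rw [PathFlows.load_eq_sum, listLoad, ← Fin.sum_univ_fun_getElem]
  rfl

theorem PathFlows.rate_le_load {N : ErasureNetwork V E} (F : N.PathFlows) {i : Fin F.num} {e : E}
    (he : e ∈ F.path i) : F.rate i ≤ F.load e := by
  classical
  exact Finset.single_le_sum (f := F.rate) (fun j _ => (F.rate_pos j).le)
    (by simpa using he)

theorem PathFlows.load_nonneg {N : ErasureNetwork V E} (F : N.PathFlows) (e : E) :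
    0 ≤ F.load e :=
  Finset.sum_nonneg fun i _ => (F.rate_pos i).le

theorem PathFlows.conserves_load [Fintype E] {N : ErasureNetwork V E} (F : N.PathFlows) :
    N.Conserves F.load := by
  classical
  intro v hs ht
  rw [F.load_eq_sum]
  refine Finset.sum_induction _ (fun h => N.divergence h v = 0) ?_ (N.divergence_zero v) ?_
  · intro a b ha hb
    rw [divergence_add, ha, hb, add_zero]
  · intro i _
    rw [divergence_smul, (F.isPath i).divergence_unitFlow]
    simp [hs.symm, ht.symm]

/-- The split capacity is exactly `F.rate i` on the saturated link `m` and exceeds it on the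
unsaturated link `e`. -/
theorem PathFlows.splitErasure_lt [Fintype E] {N : ErasureNetwork V E} (F : N.PathFlows)
    {i : Fin F.num} {e m : E} (he : e ∈ F.path i) (hlt : F.load e < N.cap e)
    (hm : F.load m = N.cap m) : F.splitErasure i e < F.splitErasure i m := by
  have hr := F.rate_pos i
  have hload : 0 < F.load e := hr.trans_le (F.rate_le_load he)
  have hcap : 0 < N.cap m := sub_pos.2 (N.p_lt_one m)
  have h1 : F.rate i / F.load m * N.cap m = F.rate i := by
    rw [hm, div_mul_cancel₀ _ hcap.ne']
  have h2 : F.rate i < F.rate i / F.load e * N.cap e := by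
    rw [div_mul_eq_mul_div, lt_div_iff₀ hload]
    exact mul_lt_mul_of_pos_left hlt hr
  unfold cap at h1 h2
  unfold PathFlows.splitErasure
  linarith

end Decomposition

/-! ### Slack off the unique bottleneck. -/

section SingleBottleneck

variable [Fintype E] (N : ErasureNetwork V E)

theorem IsFlow.conserves {N : ErasureNetwork V E} {g : E → ℝ} (hg : N.IsFlow g) :
    N.Conserves g :=
  fun v hs ht => sub_eq_zero.2 (hg.conserve v hs ht).symm

/-- The capacities can be lowered by a uniform amount on a set of links in such a way that every
set of links whose capacity exceeds `C` keeps a capacity of at least `C`. -/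
theorem exists_uniform_slack (c : E → ℝ) (hc : ∀ e, 0 < c e) (C : ℝ) :
    ∃ ε : ℝ, 0 < ε ∧ (∀ e, ε ≤ c e) ∧
      ∀ S : Finset E, C < ∑ e ∈ S, c e → C ≤ ∑ e ∈ S, (c e - ε) := by
  have h1 : ∀ᶠ ε : ℝ in nhdsWithin 0 (Set.Ioi 0), ∀ e, ε ≤ c e :=
    Filter.eventually_all.2 fun e =>
      nhdsWithin_le_nhds ((eventually_lt_nhds (hc e)).mono fun _ h => h.le)
  have h2 : ∀ᶠ ε : ℝ in nhdsWithin 0 (Set.Ioi 0),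
      ∀ S : Finset E, C < ∑ e ∈ S, c e → C ≤ ∑ e ∈ S, (c e - ε) := by
    refine Filter.eventually_all.2 fun S => ?_
    by_cases hS : C < ∑ e ∈ S, c e
    · have hcont : Continuous fun ε : ℝ => ∑ e ∈ S, (c e - ε) := by fun_prop
      have hlim : Filter.Tendsto (fun ε : ℝ => ∑ e ∈ S, (c e - ε)) (nhdsWithin 0 (Set.Ioi 0))
          (nhds (∑ e ∈ S, c e)) := by
        simpa only [sub_zero] using (hcont.tendsto 0).mono_left nhdsWithin_le_nhds
      filter_upwards [hlim.eventually_const_lt hS] with ε hε _ using hε.le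
    · exact Filter.Eventually.of_forall fun _ h => absurd h hS
  obtain ⟨ε, ⟨ha, hb⟩, hpos⟩ := ((h1.and h2).and self_mem_nhdsWithin).exists
  exact ⟨ε, hpos, ha, hb⟩

/-- A single-bottleneck network has a flow of minimum cut value that saturates no link outside the
bottleneck. -/
theorem exists_flow_lt_cap_off_bottleneck [Finite V] {X : Set V} (hX : N.IsMinCut X)
    (huniq : ∀ Y, N.IsMinCut Y → N.cutEdges Y = N.cutEdges X) :
    ∃ g : E → ℝ, (∀ e, 0 ≤ g e) ∧ (∀ e, g e ≤ N.cap e) ∧ N.Conserves g ∧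
      (∀ e ∉ N.cutEdges X, g e < N.cap e) ∧ N.divergence g N.source = N.cutCap X := by
  classical
  obtain ⟨ε, hε, hεc, hslack⟩ := exists_uniform_slack N.cap
    (fun e => sub_pos.2 (N.p_lt_one e)) (N.cutCap X)
  -- Only links off the bottleneck are lowered, so its own capacity stays `N.cutCap X`.
  let c : E → ℝ := fun e => if e ∈ N.cutEdges X then N.cap e else N.cap e - ε
  have hcle : ∀ e, c e ≤ N.cap e := fun e => by
    simp only [c]
    split_ifs <;> linarith
  have hcge : ∀ e, N.cap e - ε ≤ c e := fun e => by
    simp only [c]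
    split_ifs <;> linarith
  obtain ⟨g, ⟨h0, h1, h2⟩, Y, hY, hval⟩ := N.exists_flow_eq_cut (c := c)
    fun e => (sub_nonneg.2 (hεc e)).trans (hcge e)
  refine ⟨g, h0, fun e => (h1 e).trans (hcle e), h2, fun e he => ?_, le_antisymm ?_ ?_⟩
  · have := h1 e
    simp only [c, if_neg he] at this
    linarith
  · exact N.divergence_source_le_cut h2 h0 (fun e => (h1 e).trans (hcle e)) hX.1
  · rw [hval]
    -- `Y` is tight for the lowered capacities. Either it is a minimum cut of the original network,
    -- hence has the bottleneck's links, or its strict excess absorbs the loss of `ε` per link.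
    by_cases hmin : N.cutCap Y ≤ N.cutCap X
    · rw [huniq Y ⟨hY, fun Z hZ => hmin.trans (hX.2 Z hZ)⟩]
      exact le_of_eq (Finset.sum_congr rfl fun e he => (if_pos he).symm)
    · exact (hslack _ (not_le.1 hmin)).trans (Finset.sum_le_sum fun e _ => hcge e)

end SingleBottleneck

end ErasureNetwork

open ErasureNetwork in
theorem lemma1 {V E : Type*} [Finite V] [Fintype E] (N : ErasureNetwork V E)
    (hN : N.IsSingleBottleneck) :
    ∃ F : N.PathFlows, F.IsMaxFlowSubgraph ∧ ∀ i : Fin F.num, F.HasSingleWorstLink i := by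
  classical
  obtain ⟨D, ⟨X, hX, rfl⟩, hD⟩ := hN
  obtain ⟨g, h0, hcap, hcons, hlt, hval⟩ :=
    N.exists_flow_lt_cap_off_bottleneck hX fun Y hY => hD _ ⟨Y, hY, rfl⟩
  have hnonneg : 0 ≤ N.divergence g N.source :=
    hval ▸ Finset.sum_nonneg fun e _ => (sub_pos.2 (N.p_lt_one e)).le
  obtain ⟨L, hL, hle, hLval⟩ := N.exists_listLoad_le hcons h0 hnonneg
  let F := PathFlows.ofList L hL
  have hload : F.load = listLoad L := PathFlows.load_ofList L hL
  rw [← hload, hval] at hLval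
  rw [← hload] at hle
  have hFcap : ∀ e, F.load e ≤ N.cap e := fun e => (hle e).trans (hcap e)
  obtain ⟨hfwd, hbwd⟩ := N.tight_of_divergence_source_eq_cut F.conserves_load F.load_nonneg
    hFcap hX.1 hLval
  refine ⟨F, ⟨⟨F.load_nonneg, hFcap, fun v hs ht => ?_⟩, fun g' hg' => ?_⟩, fun i => ?_⟩
  · exact (sub_eq_zero.1 (F.conserves_load v hs ht)).symm
  · exact (N.divergence_source_le_cut hg'.conserves hg'.nonneg hg'.le_cap hX.1).trans hLval.ge
  -- A link on a path has positive load, whereas tightness gives load zero on links entering `X`.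
  · have hback : ∀ e ∈ F.path i, N.src e ∉ X → N.tgt e ∉ X := fun e he h1 h2 =>
      ((F.rate_pos i).trans_le (F.rate_le_load he)).ne' (hbwd e h1 h2)
    obtain ⟨m, hm, hmX, huniq⟩ := (F.isPath i).1.exists_unique_crossing hX.1.1 hX.1.2 hback
    refine ⟨m, hm, fun e he hem => F.splitErasure_lt he ((hle e).trans_lt (hlt e fun hcut => ?_))
      (hfwd m hmX.1 hmX.2)⟩
    obtain ⟨h1, h2⟩ : N.src e ∈ X ∧ N.tgt e ∉ X := by simpa [cutEdges] using hcut
    exact hem (huniq e he h1 h2)
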